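/- Let $R$ be a regular (commutative Noetherian) ring of prime characteristic $p$ and let $\mathfrak{a}$ be a proper ideal of $R$. Let $R'$ denote $R$ regarded as a left $R$-module in the natural way and as a right $R$-module via the Frobenius homomorphism $r \mapsto r^p$, and let $F = R' \otimes_R (-)$ be the Frobenius functor on $R$-modules. An $F$-module is an $R$-module $\mathcal{M}$ with an $R$-isomorphism $\theta : \mathcal{M} \to F(\mathcal{M})$. A generating morphism of $\mathcal{M}$ is an $R$-homomorphism $\alpha : N \to F(N)$ such that $\mathcal{M}$ is isomorphic, as an $F$-module, to the direct limit of $$N \xrightarrow{\ \alpha\ } F(N) \xrightarrow{F(\alpha)} F^2(N) \xrightarrow{F^2(\alpha)} \cdots$$ with the structure morphism induced by the maps $F^i(\alpha) : F^i(N) \to F(F^i(N))$. If $\mathcal{M}$ has a generating morphism $\alpha : N \to F(N)$ with $N$ finitely generated, then $\mathcal{M}$ is called $F$-finite; if in addition $\alpha$ is injective, then $N$ is called a root of $\mathcal{M}$. For an $R$-module $M$, a sequence $a_1, \ldots, a_n$ of elements of $R$ is an $\mathfrak{a}$-filter-regular sequence on $M$ if $$\operatorname{Supp}\Big(\big(\textstyle\sum_{j=1}^{i-1}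 a_jM :_M a_i\big)\big/\sum_{j=1}^{i-1} a_jM\Big) \subseteq \operatorname{Var}(\mathfrak{a}) = \{\mathfrak{p} \in \operatorname{Spec}(R) : \mathfrak{p} \supseteq \mathfrak{a}\} \quad \text{for all } i = 1, \ldots, n,$$ and an infinite sequence $(a_i)_{i \geq 1}$ is one if $a_1, \ldots, a_t$ is one for all $t \geq 1$. **Theorem 5.8.** Let $\mathcal{M}$ be an $F$-finite $F$-module over $R$ with root $N$. Then there exists an infinite $\mathfrak{a}$-filter-regular sequence on $N$ composed of elements of $\mathfrak{a}$, and every such sequence $(g_i)_{i \geq 1}$ is also an $\mathfrak{a}$-filter-regular sequence on $\mathcal{M}$. -/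

import Mathlib

/-! # Frobenius functor, `F`-modules and their roots, filter-regular sequences -/

open scoped TensorProduct Pointwise

universe u v w

section Frobenius

/-- The ring `R'`: a copy of `R`, which is regarded as an `R`-algebra via the Frobenius map. -/
def FrobRing (R : Type u) (_p : ℕ) : Type u := R

instance FrobRing.instCommRing (R : Type u) [CommRing R] (p : ℕ) : CommRing (FrobRing R p) :=
  inferInstanceAs (CommRing R)

/-- The identity map of `R`, as a ring isomorphism `R ≃ R'`. -/
def FrobRing.of (R : Type u) [CommRing R] (p : ℕ) : R ≃+* FrobRing R p :=
  RingEquiv.refl R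

variable (R : Type u) [CommRing R] (p : ℕ) [Fact p.Prime] [CharP R p]

/-- `R` acts on `R'` through the Frobenius homomorphism: `r • s = r ^ p * s`. -/
instance FrobRing.instAlgebra : Algebra R (FrobRing R p) :=
  ((FrobRing.of R p).toRingHom.comp (frobenius R p)).toAlgebra

/-- The Frobenius functor on objects: `F(M) = R' ⊗_R M`, where `r ^ p * s ⊗ m = s ⊗ r m`. It is
considered as an `R`-module through the natural action of `R` on the left factor `R' = R`. -/
def Frob (M : Type v) [AddCommGroup M] [Module R M] : Type (max u v) :=
  FrobRing R p ⊗[R] M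

section
variable (M : Type v) [AddCommGroup M] [Module R M]

instance Frob.instAddCommGroup : AddCommGroup (Frob R p M) :=
  inferInstanceAs (AddCommGroup (FrobRing R p ⊗[R] M))

instance Frob.instModule : Module R (Frob R p M) :=
  letI : Module (FrobRing R p) (Frob R p M) :=
    inferInstanceAs (Module (FrobRing R p) (FrobRing R p ⊗[R] M))
  Module.compHom (Frob R p M) (FrobRing.of R p).toRingHom

end

variable {R}

section
variable {M : Type v} [AddCommGroup M] [Module R M]

/-- The pure tensor `s ⊗ m` in `F(M)`. -/
def Frob.tmul (s : R) (m : M) : Frob R p M :=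
  FrobRing.of R p s ⊗ₜ[R] m

theorem Frob.smul_tmul (r s : R) (m : M) :
    r • Frob.tmul p s m = Frob.tmul p (r * s) m := rfl

theorem Frob.tmul_smul (r s : R) (m : M) :
    Frob.tmul p s (r • m) = Frob.tmul p (r ^ p * s) m :=
  (TensorProduct.tmul_smul r (FrobRing.of R p s) m).trans
    (TensorProduct.smul_tmul' r (FrobRing.of R p s) m)

end

/-- The Frobenius functor on morphisms: `F(f) (s ⊗ m) = s ⊗ f m`. -/
def Frob.map {M : Type v} {N : Type w} [AddCommGroup M] [Module R M] [AddCommGroup N] [Module R N]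
    (f : M →ₗ[R] N) : Frob R p M →ₗ[R] Frob R p N where
  toFun := f.baseChange (FrobRing R p)
  map_add' := map_add (f.baseChange (FrobRing R p))
  map_smul' r x := (f.baseChange (FrobRing R p)).map_smul (FrobRing.of R p r) x

theorem Frob.map_tmul {M : Type v} {N : Type w} [AddCommGroup M] [Module R M] [AddCommGroup N]
    [Module R N] (f : M →ₗ[R] N) (s : R) (m : M) :
    Frob.map p f (Frob.tmul p s m) = Frob.tmul p s (f m) := rfl

theorem Frob.map_comp_apply {M N P : Type*} [AddCommGroup M] [Module R M] [AddCommGroup N]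
    [Module R N] [AddCommGroup P] [Module R P] (g : N →ₗ[R] P) (f : M →ₗ[R] N) (x : Frob R p M) :
    Frob.map p (g ∘ₗ f) x = Frob.map p g (Frob.map p f x) :=
  LinearMap.congr_fun (LinearMap.baseChange_comp (A := FrobRing R p) (g := g) f) x

end Frobenius

section Generating

variable (R : Type u) [CommRing R] (p : ℕ) [Fact p.Prime] [CharP R p]

/-- The iterates `F^i(N)` of the Frobenius functor: `F^0(N) = N` and `F^(i+1)(N) = F(F^i(N))`. -/
def Frob.iter (N : Type (max u v)) [AddCommGroup N] [Module R N] : ℕ → ModuleCat.{max u v} R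
  | 0 => ModuleCat.of R N
  | i + 1 => ModuleCat.of R (Frob R p (Frob.iter N i))

variable {R}

section
variable {N : Type (max u v)} [AddCommGroup N] [Module R N] (β : N →ₗ[R] Frob R p N)

/-- The maps `F^i(β) : F^i(N) → F^(i+1)(N)` that arise from `β : N → F(N)`. -/
def Frob.iterMap : (i : ℕ) → (Frob.iter.{u, v} R p N i →ₗ[R] Frob.iter.{u, v} R p N (i + 1))
  | 0 => β
  | i + 1 => Frob.map p (Frob.iterMap i)

/-- The transition maps `F^i(N) → F^j(N)`, for `i ≤ j`, of the direct system
`N → F(N) → F^2(N) → ⋯`: composites of the maps `F^k(β)`. -/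
def Frob.transition (i j : ℕ) (h : i ≤ j) :
    Frob.iter.{u, v} R p N i →ₗ[R] Frob.iter.{u, v} R p N j :=
  Nat.leRec (motive := fun j _ => Frob.iter.{u, v} R p N i →ₗ[R] Frob.iter.{u, v} R p N j)
    LinearMap.id (fun k _ g => Frob.iterMap.{u, v} p β k ∘ₗ g) h

theorem Frob.transition_self (i : ℕ) :
    Frob.transition.{u, v} p β i i le_rfl = LinearMap.id := by
  simp [Frob.transition]

theorem Frob.transition_succ (i j : ℕ) (h : i ≤ j) :
    Frob.transition.{u, v} p β i (j + 1) (Nat.le_succ_of_le h) =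
      Frob.iterMap.{u, v} p β j ∘ₗ Frob.transition.{u, v} p β i j h :=
  Nat.leRec_succ _ _ h

/-- The direct limit of `N → F(N) → F^2(N) → ⋯`. -/
abbrev Frob.Limit : Type (max u v) :=
  Module.DirectLimit (fun i => Frob.iter.{u, v} R p N i) (Frob.transition.{u, v} p β)

/-- The canonical map from `F^i(N)` to the direct limit. -/
noncomputable abbrev Frob.toLimit (i : ℕ) : Frob.iter.{u, v} R p N i →ₗ[R] Frob.Limit.{u, v} p β :=
  Module.DirectLimit.of R ℕ (fun i => Frob.iter.{u, v} R p N i) (Frob.transition.{u, v} p β) i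

theorem Frob.toLimit_comp_iterMap (i : ℕ) :
    Frob.toLimit.{u, v} p β (i + 1) ∘ₗ Frob.iterMap.{u, v} p β i = Frob.toLimit.{u, v} p β i := by
  ext x
  have h := Module.DirectLimit.of_f (R := R) (ι := ℕ) (G := fun i => Frob.iter.{u, v} R p N i)
    (f := Frob.transition.{u, v} p β) (hij := Nat.le_succ i) (x := x)
  rw [← h, Frob.transition_succ p β i i le_rfl, Frob.transition_self]
  rfl

/-- The structure map `ψ : 𝓝 → F(𝓝)` of the direct limit `𝓝` of `N → F(N) → F^2(N) → ⋯`: the map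
that `F^i(β)` followed by the canonical map `F(F^i(N)) → F(𝓝)` defines on `F^i(N)`. -/
noncomputable def Frob.limitStructure : Frob.Limit.{u, v} p β →ₗ[R] Frob R p (Frob.Limit.{u, v} p β) :=
  Module.DirectLimit.lift R ℕ (fun i => Frob.iter.{u, v} R p N i) (Frob.transition.{u, v} p β)
    (fun i => (Frob.map p (Frob.toLimit.{u, v} p β i) :
        Frob R p (Frob.iter.{u, v} R p N i) →ₗ[R] Frob R p (Frob.Limit.{u, v} p β)) ∘ₗ
      (Frob.iterMap.{u, v} p β i :
        Frob.iter.{u, v} R p N i →ₗ[R] Frob R p (Frob.iter.{u, v} R p N i)))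
    (by
      intro i j hij x
      induction j, hij using Nat.le_induction with
      | base => rw [Frob.transition_self]; rfl
      | succ j hij ih =>
        rw [← ih, Frob.transition_succ p β i j hij]
        have h := Frob.map_comp_apply p (Frob.toLimit.{u, v} p β (j + 1))
          (Frob.iterMap.{u, v} p β j)
          (Frob.iterMap.{u, v} p β j (Frob.transition.{u, v} p β i j hij x))
        rw [Frob.toLimit_comp_iterMap] at h
        exact h.symm)

theorem Frob.limitStructure_toLimit (i : ℕ) (x : Frob.iter.{u, v} R p N i) :
    Frob.limitStructure.{u, v} p β (Frob.toLimit.{u, v} p β i x) =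
      Frob.map p (Frob.toLimit.{u, v} p β i) (Frob.iterMap.{u, v} p β i x) :=
  Module.DirectLimit.lift_of _ _ _

end

section
variable {M : Type w} [AddCommGroup M] [Module R M]
  {N : Type (max u v)} [AddCommGroup N] [Module R N]

/-- `β : N → F(N)` is a generating morphism of the `F`-module `M` with structure isomorphism
`θ : M ≃ F(M)`: the `F`-module `M` is isomorphic, by an isomorphism that respects the structure
maps, to the direct limit of `N → F(N) → F^2(N) → ⋯`. -/
def IsGeneratingMorphism (θ : M ≃ₗ[R] Frob R p M) (β : N →ₗ[R] Frob R p N) : Prop :=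
  ∃ e : Frob.Limit.{u, v} p β ≃ₗ[R] M,
    ∀ x, θ (e x) = Frob.map p e.toLinearMap (Frob.limitStructure.{u, v} p β x)

variable (N) in
/-- `N` is a root of the `F`-module `M` with structure isomorphism `θ : M ≃ F(M)`: it is finitely
generated (so that `M` is `F`-finite), and `M` has an injective generating morphism
`N → F(N)`. -/
def IsRoot (θ : M ≃ₗ[R] Frob R p M) : Prop :=
  Module.Finite R N ∧
    ∃ α : N →ₗ[R] Frob R p N, Function.Injective α ∧ IsGeneratingMorphism.{u, v, w} p θ α

end

end Generating

section FilterRegular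

variable {A : Type u} [CommRing A] (𝔟 : Ideal A) (M : Type v) [AddCommGroup M] [Module A M]

/-- The finite sequence `a_1, …, a_n` (indexed here from `0`) is `𝔟`-filter-regular on `M`:
for each `i`, with `P = ∑_{j < i} a_j M` and `P :_M a_i = {m | a_i m ∈ P}`, the support of the module
`(P :_M a_i) / P` is contained in the variety of `𝔟`. -/
def IsFilterRegularSeq {n : ℕ} (a : Fin n → A) : Prop :=
  ∀ i : Fin n,
    let P : Submodule A M := ⨆ j < i, a j • (⊤ : Submodule A M)
    let C : Submodule A M := P.comap (LinearMap.lsmul A M (a i))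
    Module.support A (C ⧸ P.submoduleOf C) ⊆ PrimeSpectrum.zeroLocus (𝔟 : Set A)

/-- The infinite sequence `g` is `𝔟`-filter-regular on `M`: all its initial segments are. -/
def IsInfiniteFilterRegularSeq (g : ℕ → A) : Prop :=
  ∀ t : ℕ, IsFilterRegularSeq 𝔟 M (fun i : Fin t => g i)

end FilterRegular

/-! The support condition is local: a sequence is `𝔞`-filter-regular on `M` exactly when it is
weakly regular on `M_q` for every prime `q` not containing `𝔞` (`isInfiniteFilterRegularSeq_iff`,
`forall_isRegularModAt_iff`). Over a regular ring Frobenius is flat (Kunz,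
`IsRegularRing.flat_frobRing`), so `F` is exact; it turns `N / IN` into `F(N) / I^[p] F(N)`, where
`I^[p]` is generated by the `p`-th powers of elements of `I`, and multiplication by `a` into
multiplication by `a ^ p`. Regularity of `g` on `N_q` thus gives regularity of the `p`-th powers on
`F(N)_q` (`IsRegularModAt.frob`), and the exponent can be dropped, since weak regularity is
insensitive to powers (`isWeaklyRegular_map_pow_iff`). So `g` is regular at `q` on every `F^i(N)`,
hence on the direct limit, where each relation already holds at a finite stage. Existence on `N` is
prime avoidance.

Flatness is checked at primes. The maximal ideal of a regular local ring is generated by a weakly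
regular sequence, which acts on `R'` through its `p`-th powers and so stays weakly regular there.
This gives `Tor₁(k, R') = 0` for the residue field `k`, and the local criterion concludes. -/

/-! ### Regular local rings: generating the maximal ideal by a regular sequence. -/

section RegularLocal

open IsLocalRing RingTheory.Sequence

theorem IsLocalRing.exists_mem_maximalIdeal_notMem_sq_notMem_minimalPrimes {R : Type*} [CommRing R]
    [IsLocalRing R] [IsNoetherianRing R] (h : 0 < ringKrullDim R) :
    ∃ x ∈ maximalIdeal R, x ∉ maximalIdeal R ^ 2 ∧ ∀ P ∈ minimalPrimes R, x ∉ P := by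
  have hmin : maximalIdeal R ∉ minimalPrimes R := by
    intro hm
    rw [← maximalIdeal_height_eq_ringKrullDim, Ideal.height_eq_zero_iff.mpr hm] at h
    simp at h
  by_contra! hcon
  have hsub : (maximalIdeal R : Set R) ⊆
      ⋃ I ∈ insert (maximalIdeal R ^ 2) (minimalPrimes R), ((id I : Ideal R) : Set R) := by
    intro x hx
    by_cases hx2 : x ∈ maximalIdeal R ^ 2
    · exact Set.mem_biUnion (Set.mem_insert _ _) hx2
    · obtain ⟨P, hP, hxP⟩ := hcon x hx hx2
      exact Set.mem_biUnion (Set.mem_insert_of_mem _ hP) hxP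
  -- Prime avoidance allows two ideals that are not prime; `𝔪²` fills both places. Of the two
  -- outcomes, `𝔪 ≤ 𝔪²` forces `𝔪 = 0` by Nakayama, and `𝔪` inside a minimal prime forces height
  -- zero.
  rw [Ideal.subset_union_prime_finite ((minimalPrimes.finite_of_isNoetherianRing R).insert _)
    (maximalIdeal R ^ 2) (maximalIdeal R ^ 2)] at hsub
  · obtain ⟨I, hI, hle⟩ := hsub
    rcases hI with rfl | hI
    · have hbot : maximalIdeal R = ⊥ := by
        refine Submodule.eq_bot_of_le_smul_of_le_jacobson_bot (maximalIdeal R) _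
          (IsNoetherian.noetherian _) ?_ (maximalIdeal_le_jacobson _)
        simpa [sq] using hle
      have := ringKrullDim_le_spanFinrank_maximalIdeal R
      rw [hbot] at this
      simp at this
      exact absurd h this.not_gt
    · have hP : I.IsPrime := hI.1.1
      have : maximalIdeal R = I := le_antisymm hle (le_maximalIdeal hP.ne_top)
      exact hmin (this ▸ hI)
  · rintro I (rfl | hI) h1 -
    · exact absurd rfl h1
    · exact hI.1.1

/-- Since `x ∉ 𝔪²`, some coefficient of `x` in terms of the generators is a unit, and that generator
can be exchanged for `x`. -/
theorem IsLocalRing.exists_span_erase_sup_of_notMem_sq {R : Type*} [CommRing R] [IsLocalRing R]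
    [DecidableEq R] {s : Finset R} (hs : Ideal.span (s : Set R) = maximalIdeal R) {x : R}
    (hx : x ∈ maximalIdeal R) (hx2 : x ∉ maximalIdeal R ^ 2) :
    ∃ a ∈ s, maximalIdeal R = Ideal.span {x} ⊔ Ideal.span (s.erase a : Set R) := by
  obtain ⟨c, hc⟩ := Submodule.mem_span_finset'.mp (hs ▸ hx : x ∈ Ideal.span (s : Set R))
  have hsm : ∀ a ∈ s, a ∈ maximalIdeal R := fun a ha => hs ▸ Ideal.subset_span ha
  obtain ⟨a, ha⟩ : ∃ a, IsUnit (c a) := by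
    by_contra! hcon
    apply hx2
    rw [← hc, sq]
    exact Ideal.sum_mem _ fun a _ => Ideal.mul_mem_mul (hcon a) (hsm a a.2)
  refine ⟨a, a.2, le_antisymm ?_ ?_⟩
  · rw [← hs, Ideal.span_le]
    intro b hb
    by_cases hba : b = a
    · have hmem : c a * a ∈ Ideal.span {x} ⊔ Ideal.span (s.erase a : Set R) := by
        have hsum : c a * a = x - ∑ i ∈ Finset.univ.erase a, c i * (i : R) := by
          rw [← hc, ← Finset.add_sum_erase _ _ (Finset.mem_univ a)]
          simp
        rw [hsum]
        refine sub_mem (Ideal.mem_sup_left (Ideal.mem_span_singleton_self x))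
          (Ideal.mem_sup_right (Ideal.sum_mem _ fun i hi => Ideal.mul_mem_left _ _
            (Ideal.subset_span ?_)))
        have : (i : R) ≠ a := fun h => (Finset.ne_of_mem_erase hi) (Subtype.ext h)
        simp [this]
      rw [hba]
      exact (Ideal.unit_mul_mem_iff_mem _ ha).mp hmem
    · exact Ideal.mem_sup_right (Ideal.subset_span (by simpa [hba] using hb))
  · refine sup_le ((Ideal.span_singleton_le_iff_mem _).mpr hx) (Ideal.span_le.mpr fun b hb => ?_)
    exact hsm b (Finset.mem_of_mem_erase hb)

/-- A minimal prime `P` inside `(x)` does not contain `x`, so `P = xP`, and Nakayama gives `P = 0`.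
-/
theorem IsLocalRing.isDomain_of_isPrime_span_singleton {R : Type*} [CommRing R] [IsLocalRing R]
    [IsNoetherianRing R] {x : R} (hx : x ∈ maximalIdeal R) (hp : (Ideal.span {x}).IsPrime)
    (hmin : ∀ P ∈ minimalPrimes R, x ∉ P) : IsDomain R := by
  obtain ⟨P, hP, hPx⟩ := Ideal.exists_minimalPrimes_le (I := ⊥) (J := Ideal.span {x}) bot_le
  have hPprime : P.IsPrime := hP.1.1
  have hle : P ≤ Ideal.span {x} • P := by
    intro y hy
    obtain ⟨z, rfl⟩ := Ideal.mem_span_singleton.mp (hPx hy)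
    exact Submodule.smul_mem_smul (Ideal.mem_span_singleton_self x)
      ((hPprime.mem_or_mem hy).resolve_left (hmin P hP))
  have hbot : P = ⊥ := Submodule.eq_bot_of_le_smul_of_le_jacobson_bot (Ideal.span {x}) _
    (IsNoetherian.noetherian _) hle (((Ideal.span_singleton_le_iff_mem _).mpr hx).trans
      (maximalIdeal_le_jacobson _))
  subst hbot
  exact IsDomain.of_bot_isPrime R

theorem isWeaklyRegular_cons_of_quotient {R : Type*} [CommRing R] {x : R} {xs : List R}
    (hx : IsSMulRegular R x)
    (hxs : IsWeaklyRegular (R ⧸ Ideal.span {x}) (xs.map (Ideal.Quotient.mk (Ideal.span {x})))) :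
    IsWeaklyRegular R (x :: xs) := by
  refine .cons hx ?_
  have h := (isWeaklyRegular_map_algebraMap_iff (R := R) (S := R ⧸ Ideal.span {x})
    (M := R ⧸ Ideal.span {x}) xs).mp hxs
  have e : x • (⊤ : Submodule R R) = Ideal.span {x} := by
    rw [← Submodule.ideal_span_singleton_smul]; simp
  exact ((Submodule.quotEquivOfEq _ _ e).isWeaklyRegular_congr xs).mpr h

/-- Modulo a suitable `x` the number of generators drops by one and the dimension by at most one, so
the pair of inequalities on `n` is inherited by `R / (x)`. Being a domain is part of the induction:
it makes `(x)` prime, whence `R` is a domain and `x` is regular. -/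
theorem IsLocalRing.isDomain_and_exists_isWeaklyRegular (n : ℕ) : ∀ (R : Type u) [CommRing R]
    [IsLocalRing R] [IsNoetherianRing R] (s : Finset R),
    Ideal.span (s : Set R) = maximalIdeal R → s.card ≤ n → n ≤ ringKrullDim R →
      IsDomain R ∧ ∃ xs : List R, Ideal.ofList xs = maximalIdeal R ∧ IsWeaklyRegular R xs := by
  induction n with
  | zero =>
    intro R _ _ _ s hs hcard _
    have hbot : maximalIdeal R = ⊥ := by
      rw [← hs, Finset.card_eq_zero.mp (Nat.le_zero.mp hcard)]; simp
    refine ⟨?_, [], by simp [hbot], .nil R R⟩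
    exact (isField_iff_maximalIdeal_eq.mpr hbot).isDomain
  | succ n ih =>
    intro R _ _ _ s hs hcard hdim
    classical
    have hpos : 0 < ringKrullDim R := lt_of_lt_of_le (by exact_mod_cast n.succ_pos) hdim
    obtain ⟨x, hx, hx2, hmin⟩ := exists_mem_maximalIdeal_notMem_sq_notMem_minimalPrimes hpos
    obtain ⟨a, ha, hmax⟩ := exists_span_erase_sup_of_notMem_sq hs hx hx2
    set mk := Ideal.Quotient.mk (Ideal.span {x}) with hmk
    have hmksurj : Function.Surjective mk := Ideal.Quotient.mk_surjective
    have : Nontrivial (R ⧸ Ideal.span {x}) := Ideal.Quotient.nontrivial_iff.mpr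
      (ne_top_of_le_ne_top (maximalIdeal.isMaximal R).ne_top
        ((Ideal.span_singleton_le_iff_mem _).mpr hx))
    have hloc : IsLocalRing (R ⧸ Ideal.span {x}) := .of_surjective' mk hmksurj
    have : IsLocalHom mk := .of_surjective mk hmksurj
    have hmaxmap : (maximalIdeal R).map mk = maximalIdeal (R ⧸ Ideal.span {x}) :=
      ((local_hom_TFAE mk).out 0 4 |>.mp ‹_›) ▸ Ideal.map_comap_of_surjective mk hmksurj _
    have hxmap : (Ideal.span {x}).map mk = ⊥ := by simp [hmk]
    obtain ⟨hdom, ys, hys, hreg⟩ := ih (R ⧸ Ideal.span {x}) ((s.erase a).image mk) (by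
        rw [← hmaxmap, hmax, Ideal.map_sup, hxmap, bot_sup_eq, Ideal.map_span, Finset.coe_image])
      (Finset.card_image_le.trans (by rw [Finset.card_erase_of_mem ha]; omega)) (by
        have h1 := hdim.trans (ringKrullDim_le_ringKrullDim_quotient_add_encard {x} (by
          simpa [ringJacobson_eq_maximalIdeal R] using hx))
        simp only [Set.encard_singleton, Nat.cast_add, Nat.cast_one] at h1
        exact ENat.WithBot.add_le_add_one_right_iff.mp h1)
    have hp : (Ideal.span {x}).IsPrime := (Ideal.Quotient.isDomain_iff_prime _).mp hdom
    have hR : IsDomain R := isDomain_of_isPrime_span_singleton hx hp hmin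
    refine ⟨hR, ?_⟩
    obtain ⟨zs, rfl⟩ : ∃ zs : List R, zs.map mk = ys :=
      List.map_surjective_iff.mpr hmksurj ys
    have hx0 : x ≠ 0 := fun h => hx2 (h ▸ zero_mem _)
    refine ⟨x :: zs, ?_, isWeaklyRegular_cons_of_quotient
      ((IsRegular.of_ne_zero hx0).left) hreg⟩
    have hker : RingHom.ker mk = Ideal.span {x} := Ideal.mk_ker
    have h2 : (Ideal.ofList zs).map mk = (maximalIdeal R).map mk := by
      rw [Ideal.map_ofList, hys, hmaxmap]
    -- Pulling back along the quotient map adds `(x)` to both sides, and `𝔪` already contains it.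
    have h3 := congrArg (Ideal.comap mk) h2
    rw [Ideal.comap_map_of_surjective' mk hmksurj, Ideal.comap_map_of_surjective' mk hmksurj,
      hker, sup_eq_left.mpr ((Ideal.span_singleton_le_iff_mem _).mpr hx)] at h3
    rw [Ideal.ofList_cons, sup_comm, h3]

/-- The maximal ideal of a regular local ring is generated by a regular sequence. -/
theorem IsRegularLocalRing.exists_ofList_eq_maximalIdeal_and_isWeaklyRegular (R : Type u)
    [CommRing R] [IsRegularLocalRing R] :
    ∃ xs : List R, Ideal.ofList xs = maximalIdeal R ∧ IsWeaklyRegular R xs := by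
  obtain ⟨s, hs, hspan⟩ := Submodule.FG.exists_span_finset_card_eq_spanFinrank
    (IsNoetherian.noetherian (maximalIdeal R))
  refine (isDomain_and_exists_isWeaklyRegular s.card R s hspan le_rfl ?_).2
  rw [hs, spanFinrank_maximalIdeal]

end RegularLocal

/-! ### The local criterion of flatness, with injectivity of `S ⊗ I → S` in the role of `Tor₁(R / I,
S) = 0`. -/

section LocalCriterion

open IsLocalRing RingTheory.Sequence

variable {R : Type*} [CommRing R]

/-- If `J = I + (b)` and `K = (I : b)`, then injectivity of `S ⊗ K → S ⊗ R` implies injectivity of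
`S ⊗ I → S ⊗ J`. -/
theorem Ideal.lTensor_inclusion_injective_of_colon {S : Type*} [AddCommGroup S] [Module R S]
    {I J K : Ideal R} {b : R} (hIJ : I ≤ J) (hb : b ∈ J) (hJ : J ≤ I ⊔ Ideal.span {b})
    (hK : ∀ r, r ∈ K ↔ r * b ∈ I) (h : Function.Injective (K.subtype.lTensor S)) :
    Function.Injective ((Submodule.inclusion hIJ).lTensor S) := by
  let q : I × R →ₗ[R] J :=
    (Submodule.inclusion hIJ).coprod (LinearMap.toSpanSingleton R J ⟨b, hb⟩)
  let g : K →ₗ[R] I := ((LinearMap.mulRight R b).comp K.subtype).codRestrict I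
    fun r => (hK r).mp r.2
  -- `K → I × R → J → 0` is exact, with `k r = (-rb, r)`. An element of `S ⊗ I` that dies in `S ⊗ J`
  -- comes from `S ⊗ K`, and its zero second component kills that preimage.
  let k : K →ₗ[R] I × R := (-g).prod K.subtype
  have hq : Function.Surjective q := by
    rintro ⟨y, hy⟩
    obtain ⟨i, hi, c, hc, rfl⟩ := Submodule.mem_sup.mp (hJ hy)
    obtain ⟨r, rfl⟩ := Ideal.mem_span_singleton'.mp hc
    exact ⟨(⟨i, hi⟩, r), Subtype.ext rfl⟩
  have hkq : Function.Exact k q := by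
    rintro ⟨i, r⟩
    have hval : ((q (i, r) : J) : R) = i + r * b := rfl
    constructor
    · intro h0
      have h1 : (i : R) + r * b = 0 := by rw [← hval, h0]; rfl
      have hr : r ∈ K := by
        rw [hK, eq_neg_of_add_eq_zero_right h1]
        exact neg_mem i.2
      refine ⟨⟨r, hr⟩, Prod.ext (Subtype.ext ?_) rfl⟩
      exact (eq_neg_of_add_eq_zero_left h1).symm
    · rintro ⟨c, hc⟩
      obtain ⟨rfl, rfl⟩ := Prod.mk.inj hc
      refine Subtype.ext ?_
      rw [hval]
      exact neg_add_cancel ((c : R) * b)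
  rw [injective_iff_map_eq_zero]
  intro z hz
  have h1 : q.lTensor S ((LinearMap.inl R I R).lTensor S z) = 0 := by
    rw [← LinearMap.lTensor_comp_apply, LinearMap.coprod_inl, hz]
  obtain ⟨w, hw⟩ := (lTensor_exact S hkq hq _).mp h1
  have h2 : K.subtype.lTensor S w = 0 := by
    have h3 := congrArg ((LinearMap.snd R I R).lTensor S) hw
    rwa [← LinearMap.lTensor_comp_apply, ← LinearMap.lTensor_comp_apply, LinearMap.snd_prod,
      LinearMap.snd_comp_inl, LinearMap.lTensor_zero, LinearMap.zero_apply] at h3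
  rw [(injective_iff_map_eq_zero _).mp h w h2, map_zero] at hw
  have h4 := congrArg ((LinearMap.fst R I R).lTensor S) hw
  rwa [← LinearMap.lTensor_comp_apply, LinearMap.fst_comp_inl, LinearMap.lTensor_id_apply, map_zero,
    eq_comm] at h4

theorem Ideal.rid_lTensor_subtype_mem {S : Type*} [AddCommGroup S] [Module R S] (I : Ideal R)
    (w : S ⊗[R] I) :
    TensorProduct.rid R S (I.subtype.lTensor S w) ∈ I • (⊤ : Submodule R S) := by
  induction w with
  | zero => simp
  | tmul s i => exact Submodule.smul_mem_smul i.2 trivial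
  | add x y hx hy => rw [map_add, map_add]; exact add_mem hx hy

/-- Every tensor is the image of some `w ∈ S ⊗ I` plus some `s ⊗ a`. If it maps to zero then `a s ∈
IS`, so `s ∈ IS` by regularity, and `s ⊗ a` itself comes from `S ⊗ I`. -/
theorem Ideal.lTensor_subtype_sup_span_singleton_injective {S : Type*} [AddCommGroup S] [Module R S]
    {I : Ideal R} {a : R} (h : Function.Injective (I.subtype.lTensor S))
    (ha : IsSMulRegular (S ⧸ I • (⊤ : Submodule R S)) a) :
    Function.Injective ((I ⊔ Ideal.span {a}).subtype.lTensor S) := by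
  set J := I ⊔ Ideal.span {a} with hJ
  have haJ : a ∈ J := Ideal.mem_sup_right (Ideal.mem_span_singleton_self a)
  let ι : I →ₗ[R] J := Submodule.inclusion le_sup_left
  have hdec : ∀ z : S ⊗[R] J, ∃ (w : S ⊗[R] I) (s : S),
      z = ι.lTensor S w + s ⊗ₜ[R] (⟨a, haJ⟩ : J) := by
    intro z
    induction z with
    | zero => exact ⟨0, 0, by simp⟩
    | tmul s y =>
      obtain ⟨y, hy⟩ := y
      obtain ⟨i, hi, c, hc, rfl⟩ := Submodule.mem_sup.mp hy
      obtain ⟨r, rfl⟩ := Ideal.mem_span_singleton'.mp hc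
      refine ⟨s ⊗ₜ ⟨i, hi⟩, r • s, ?_⟩
      rw [LinearMap.lTensor_tmul, TensorProduct.smul_tmul, ← TensorProduct.tmul_add]
      rfl
    | add x y hx hy =>
      obtain ⟨w, s, rfl⟩ := hx
      obtain ⟨w', s', rfl⟩ := hy
      exact ⟨w + w', s + s', by rw [map_add, TensorProduct.add_tmul]; abel⟩
  have hmul : ∀ s ∈ I • (⊤ : Submodule R S), ∃ w : S ⊗[R] I,
      s ⊗ₜ[R] (⟨a, haJ⟩ : J) = ι.lTensor S w := by
    intro s hs
    induction hs using Submodule.smul_induction_on' with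
    | smul i hi s _ =>
      refine ⟨s ⊗ₜ ⟨i * a, I.mul_mem_right a hi⟩, ?_⟩
      rw [LinearMap.lTensor_tmul, TensorProduct.smul_tmul]
      rfl
    | add x _ y _ hx hy =>
      obtain ⟨w, hw⟩ := hx
      obtain ⟨w', hw'⟩ := hy
      exact ⟨w + w', by rw [TensorProduct.add_tmul, hw, hw', map_add]⟩
  have hcomp : ∀ w, J.subtype.lTensor S (ι.lTensor S w) = I.subtype.lTensor S w := by
    intro w
    rw [← LinearMap.lTensor_comp_apply]
    rfl
  rw [injective_iff_map_eq_zero]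
  intro z hz
  obtain ⟨w, s, rfl⟩ := hdec z
  have h1 : a • s ∈ I • (⊤ : Submodule R S) := by
    have h2 := congrArg (TensorProduct.rid R S) hz
    rw [map_add, hcomp, map_add, map_zero, LinearMap.lTensor_tmul] at h2
    have h3 : TensorProduct.rid R S (s ⊗ₜ[R] J.subtype ⟨a, haJ⟩) = a • s := by simp
    rw [h3] at h2
    rw [eq_neg_of_add_eq_zero_right h2]
    exact neg_mem (I.rid_lTensor_subtype_mem w)
  obtain ⟨w', hw'⟩ := hmul s (mem_of_isSMulRegular_quotient_of_smul_mem ha h1)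
  rw [hw', ← map_add, hcomp] at hz
  rw [hw', ← map_add, (injective_iff_map_eq_zero _).mp h _ hz, map_zero]

theorem RingTheory.Sequence.IsWeaklyRegular.lTensor_subtype_ofList_injective {S : Type*}
    [AddCommGroup S] [Module R S] {xs : List R} (h : IsWeaklyRegular S xs) :
    Function.Injective ((Ideal.ofList xs).subtype.lTensor S) := by
  suffices ∀ i ≤ xs.length, Function.Injective ((Ideal.ofList (xs.take i)).subtype.lTensor S) by
    have h := this xs.length le_rfl
    rwa [List.take_length] at h
  intro i
  induction i with
  | zero =>
    intro _
    rw [List.take_zero, Ideal.ofList_nil]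
    exact Function.injective_of_subsingleton _
  | succ i ih =>
    intro hi
    rw [← List.take_append_getElem hi, Ideal.ofList_append, Ideal.ofList_singleton]
    exact Ideal.lTensor_subtype_sup_span_singleton_injective (ih (by omega))
      (h.regular_mod_prev i hi)

/-- This is dévissage of `R / I` into copies of the residue field. Noetherian induction enlarges `I`
by an element `a ∉ I` with `𝔪 a ⊆ I`, for which `(I : a) = 𝔪`. -/
theorem IsLocalRing.lTensor_subtype_injective_of_maximalIdeal_pow_le [IsLocalRing R]
    [IsNoetherianRing R] {S : Type*} [AddCommGroup S] [Module R S]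
    (h : Function.Injective ((maximalIdeal R).subtype.lTensor S)) (n : ℕ) (I : Ideal R)
    (hI : maximalIdeal R ^ n ≤ I) : Function.Injective (I.subtype.lTensor S) := by
  classical
  induction I using WellFoundedGT.induction with
  | ind I ih =>
    by_cases htop : I = ⊤
    · subst htop
      exact (LinearEquiv.lTensor S (Submodule.topEquiv (R := R) (M := R))).injective
    · have hex : ∃ k, maximalIdeal R ^ k ≤ I := ⟨n, hI⟩
      obtain ⟨k, hk⟩ : ∃ k, Nat.find hex = k + 1 := by
        refine Nat.exists_eq_succ_of_ne_zero fun h0 => htop ?_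
        have := Nat.find_spec hex
        rwa [h0, pow_zero, Ideal.one_eq_top, top_le_iff] at this
      have hk1 : maximalIdeal R ^ (k + 1) ≤ I := hk ▸ Nat.find_spec hex
      have hk0 : ¬ maximalIdeal R ^ k ≤ I := Nat.find_min hex (by omega)
      obtain ⟨a, ha, haI⟩ := Set.not_subset.mp hk0
      have hlt : I < I ⊔ Ideal.span {a} := lt_of_le_of_ne le_sup_left fun he =>
        haI (he ▸ Ideal.mem_sup_right (Ideal.mem_span_singleton_self a))
      have hcolon : ∀ r, r ∈ maximalIdeal R ↔ r * a ∈ I := by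
        intro r
        constructor
        · intro hr
          exact hk1 (by rw [pow_succ']; exact Ideal.mul_mem_mul hr ha)
        · intro hra hr
          exact haI ((Ideal.unit_mul_mem_iff_mem I hr).mp hra)
      have h1 := Ideal.lTensor_inclusion_injective_of_colon (S := S) le_sup_left
        (Ideal.mem_sup_right (Ideal.mem_span_singleton_self a)) le_rfl hcolon h
      have h2 := (ih _ hlt (hI.trans hlt.le)).comp h1
      rw [← LinearMap.coe_comp, ← LinearMap.lTensor_comp] at h2
      exact h2

/-- Tensor `I / (I ∩ J) ≅ (I + J) / J` with `S` and use right exactness. The factor `comap I.subtype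
I` is all of `I`; it matches the form of the second isomorphism theorem. -/
theorem Ideal.mem_range_lTensor_of_lTensor_inclusion_eq_zero {S : Type*} [AddCommGroup S]
    [Module R S] {I J : Ideal R} {z : S ⊗[R] I}
    (hz : (Submodule.inclusion (le_sup_left : I ≤ I ⊔ J)).lTensor S z = 0) :
    z ∈ LinearMap.range ((Submodule.comap I.subtype I ⊓ Submodule.comap I.subtype J).subtype.lTensor S) := by
  let e := LinearMap.quotientInfEquivSupQuotient I J
  have hcomp : e.toLinearMap ∘ₗ (Submodule.comap I.subtype I ⊓ Submodule.comap I.subtype J).mkQ =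
      (Submodule.comap (I ⊔ J).subtype J).mkQ ∘ₗ Submodule.inclusion le_sup_left := rfl
  have h1 : (Submodule.comap I.subtype I ⊓ Submodule.comap I.subtype J).mkQ.lTensor S z = 0 := by
    have h2 := congrArg (LinearMap.lTensor S (Submodule.comap (I ⊔ J).subtype J).mkQ) hz
    rw [← LinearMap.lTensor_comp_apply, ← hcomp, LinearMap.lTensor_comp_apply, map_zero] at h2
    exact (LinearEquiv.lTensor S e).map_eq_zero_iff.mp h2
  exact (lTensor_exact S (LinearMap.exact_subtype_mkQ _) (Submodule.mkQ_surjective _) z).mp h1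

/-- A form of the local criterion of flatness. -/
theorem Module.Flat.of_lTensor_maximalIdeal_injective [IsLocalRing R] [IsNoetherianRing R]
    {S : Type*} [CommRing S] [IsLocalRing S] [IsNoetherianRing S] [Algebra R S]
    (hS : (maximalIdeal R).map (algebraMap R S) ≠ ⊤)
    (h : Function.Injective ((maximalIdeal R).subtype.lTensor S)) : Module.Flat R S := by
  rw [Module.Flat.iff_lTensor_injective']
  intro I
  rw [injective_iff_map_eq_zero]
  intro z hz
  set 𝔫 := (maximalIdeal R).map (algebraMap R S)
  have hmem : ∀ n, ∀ y ∈ maximalIdeal R ^ n • (⊤ : Submodule R I), ∀ s : S,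
      s ⊗ₜ[R] y ∈ 𝔫 ^ n • (⊤ : Submodule S (S ⊗[R] I)) := by
    intro n y hy s
    induction hy using Submodule.smul_induction_on' with
    | smul r hr y _ =>
      rw [← TensorProduct.smul_tmul, algebra_compatible_smul S r s, ← TensorProduct.smul_tmul']
      refine Submodule.smul_mem_smul ?_ trivial
      rw [← Ideal.map_pow]
      exact Ideal.mem_map_of_mem _ hr
    | add x _ y _ hx hy => rw [TensorProduct.tmul_add]; exact add_mem hx hy
  -- Krull's intersection theorem will give `z = 0`. For each `n`, `z` dies in `S ⊗ (I + 𝔪^(n+k))`,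
  -- hence comes from `I ∩ 𝔪^(n+k)`, which Artin–Rees places inside `𝔪^n I`.
  have hall : z ∈ (⨅ n : ℕ, 𝔫 ^ n • ⊤ : Submodule S (S ⊗[R] I)) := by
    rw [Submodule.mem_iInf]
    intro n
    obtain ⟨k, hk⟩ := (maximalIdeal R).exists_pow_inf_eq_pow_smul I
    have hle : Submodule.comap I.subtype I ⊓ Submodule.comap I.subtype (maximalIdeal R ^ (n + k)) ≤
        maximalIdeal R ^ n • (⊤ : Submodule R I) := by
      intro y hy
      have h1 : (y : R) ∈ maximalIdeal R ^ (n + k) • (⊤ : Ideal R) ⊓ I :=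
        ⟨by simpa using hy.2, y.2⟩
      rw [hk _ (Nat.le_add_left k n), Nat.add_sub_cancel] at h1
      have h2 : (y : R) ∈ (maximalIdeal R ^ n • (⊤ : Submodule R I)).map I.subtype := by
        rw [Submodule.map_smul'', Submodule.map_top, Submodule.range_subtype]
        exact Submodule.smul_mono le_rfl inf_le_right h1
      obtain ⟨y', hy', hyy⟩ := h2
      rwa [← Subtype.ext hyy]
    have hinj := lTensor_subtype_injective_of_maximalIdeal_pow_le h (n + k)
      (I ⊔ maximalIdeal R ^ (n + k)) le_sup_right
    obtain ⟨w, rfl⟩ := Ideal.mem_range_lTensor_of_lTensor_inclusion_eq_zero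
      (J := maximalIdeal R ^ (n + k)) (z := z) (by
        refine (injective_iff_map_eq_zero _).mp hinj _ ?_
        rw [← LinearMap.lTensor_comp_apply]
        exact hz)
    clear hz
    induction w with
    | zero => rw [map_zero]; exact zero_mem _
    | tmul s y => exact hmem n _ (hle y.2) s
    | add x y hx hy => rw [map_add]; exact add_mem hx hy
  rwa [Ideal.iInf_pow_smul_eq_bot_of_isLocalRing 𝔫 hS] at hall

end LocalCriterion

/-! ### Weak regularity is unchanged by raising all terms to a power. -/

section Powers

open RingTheory.Sequence

variable {R : Type*} [CommRing R]

/-- The two ways of killing `x` and `y` in a module agree. -/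
noncomputable def QuotSMulTop.comm (M : Type*) [AddCommGroup M] [Module R M] (x y : R) :
    QuotSMulTop y (QuotSMulTop x M) ≃ₗ[R] QuotSMulTop x (QuotSMulTop y M) :=
  Submodule.quotEquivOfEq _ _ (by rw [Submodule.map_pointwise_smul, Submodule.map_top,
      Submodule.range_mkQ]) ≪≫ₗ
    Submodule.quotientQuotientEquivQuotientSup (x • ⊤) (y • ⊤) ≪≫ₗ
    Submodule.quotEquivOfEq _ _ (sup_comm _ _) ≪≫ₗ
    (Submodule.quotientQuotientEquivQuotientSup (y • ⊤) (x • ⊤)).symm ≪≫ₗ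
    Submodule.quotEquivOfEq _ _ (by rw [Submodule.map_pointwise_smul, Submodule.map_top,
      Submodule.range_mkQ])

theorem QuotSMulTop.isSMulRegular_iff {M : Type*} [AddCommGroup M] [Module R M] {x y : R} :
    IsSMulRegular (QuotSMulTop x M) y ↔ ∀ m m' : M, y • m = x • m' → ∃ n, m = x • n := by
  rw [isSMulRegular_quotient_iff_mem_of_smul_mem]
  simp only [Submodule.mem_smul_pointwise_iff_exists, Submodule.mem_top, true_and]
  exact ⟨fun h m m' e => (h m ⟨m', e.symm⟩).imp fun _ => Eq.symm,
    fun h m ⟨m', e⟩ => (h m m' e.symm).imp fun _ => Eq.symm⟩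

variable {x : R} {a : ℕ}

/-- The multiplications by powers of `x` with exponents at most `a` behave on the quotients
`M / x ^ i M` as if `x` were regular on `M`. -/
def PowCancels (M : Type*) [AddCommGroup M] [Module R M] (x : R) (a : ℕ) : Prop :=
  ∀ i j : ℕ, i + j ≤ a → ∀ m m' : M, x ^ i • m = x ^ (i + j) • m' → ∃ n, m = x ^ j • n

theorem IsSMulRegular.powCancels {M : Type*} [AddCommGroup M] [Module R M]
    (h : IsSMulRegular M x) (a : ℕ) : PowCancels M x a := by
  intro i j _ m m' e
  rw [pow_add, mul_smul] at e
  exact ⟨m', h.pow i e⟩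

namespace PowCancels

theorem isSMulRegular_quotient {M : Type*} [AddCommGroup M] [Module R M]
    (hM : PowCancels M x a) {y : R} {b c : ℕ} (hb : 0 < b) (hba : b ≤ a) (hca : c ≤ a)
    (h : IsSMulRegular (QuotSMulTop (x ^ b) M) y) : IsSMulRegular (QuotSMulTop (x ^ c) M) y := by
  rw [QuotSMulTop.isSMulRegular_iff] at h ⊢
  -- From exponent `b` down to `1`: multiply the relation by `x ^ (b - 1)`, then cancel. Induction
  -- afterwards climbs from `1` to `c`.
  have h1 : ∀ m m' : M, y • m = x • m' → ∃ n, m = x • n := by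
    intro m m' e
    obtain ⟨k, rfl⟩ : ∃ k, b = k + 1 := Nat.exists_eq_succ_of_ne_zero hb.ne'
    obtain ⟨n, hn⟩ := h (x ^ k • m) m' (by rw [smul_comm, e, pow_succ, mul_smul])
    simpa using hM k 1 hba m n hn
  clear h
  induction c with
  | zero => exact fun m _ _ => ⟨m, by simp⟩
  | succ c ih =>
    intro m m' e
    obtain ⟨n, rfl⟩ := ih (by omega) m (x • m') (by rw [e, pow_succ, mul_smul])
    rw [smul_comm] at e
    obtain ⟨k, hk⟩ := hM c 1 hca _ _ e
    rw [pow_one] at hk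
    obtain ⟨l, rfl⟩ := h1 _ _ hk
    exact ⟨l, by rw [pow_succ, mul_smul]⟩

theorem quotient {M : Type*} [AddCommGroup M] [Module R M] (hM : PowCancels M x a) {y : R}
    (h : ∀ c ≤ a, IsSMulRegular (QuotSMulTop (x ^ c) M) y) :
    PowCancels (QuotSMulTop y M) x a := by
  intro i j hij m m' e
  obtain ⟨m, rfl⟩ := Submodule.mkQ_surjective _ m
  obtain ⟨m', rfl⟩ := Submodule.mkQ_surjective _ m'
  rw [← map_smul, ← map_smul, ← sub_eq_zero, ← map_sub, ← LinearMap.mem_ker, Submodule.ker_mkQ,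
    Submodule.mem_smul_pointwise_iff_exists] at e
  obtain ⟨n, -, hn⟩ := e
  rw [pow_add, mul_smul, ← smul_sub] at hn
  obtain ⟨n', rfl⟩ := QuotSMulTop.isSMulRegular_iff.mp (h i (by omega)) n _ hn
  rw [smul_comm, eq_comm, ← sub_eq_zero, ← smul_sub] at hn
  -- Cancelling `x ^ i` from an element it kills only places that element in `x ^ j M`, which
  -- suffices here.
  obtain ⟨k, hk⟩ := hM i j hij _ 0 (by rw [hn, smul_zero])
  refine ⟨Submodule.mkQ _ (k + m'), ?_⟩
  rw [← map_smul, ← sub_eq_zero, ← map_sub, ← LinearMap.mem_ker, Submodule.ker_mkQ,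
    Submodule.mem_smul_pointwise_iff_exists]
  exact ⟨n', trivial, by rw [smul_add, ← hk]; abel⟩

/-- The quotients by `y` and by a power of `x` commute, so `y` can be killed first; `M / yM`
inherits the cancellation property and the induction continues there. -/
theorem isWeaklyRegular {b c : ℕ} (hb : 0 < b) (hba : b ≤ a) (hca : c ≤ a) (ys : List R) :
    ∀ {M : Type w} [AddCommGroup M] [Module R M], PowCancels M x a →
      IsWeaklyRegular (QuotSMulTop (x ^ b) M) ys → IsWeaklyRegular (QuotSMulTop (x ^ c) M) ys := by
  induction ys with
  | nil => intro M _ _ _ _; exact .nil _ _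
  | cons y ys ih =>
    intro M _ _ hM h
    obtain ⟨hy, hys⟩ := (isWeaklyRegular_cons_iff _ _ _).mp h
    have hreg : ∀ d ≤ a, IsSMulRegular (QuotSMulTop (x ^ d) M) y := fun d hd =>
      hM.isSMulRegular_quotient hb hba hd hy
    refine .cons (hreg c hca) ?_
    rw [(QuotSMulTop.comm M (x ^ c) y).isWeaklyRegular_congr]
    rw [(QuotSMulTop.comm M (x ^ b) y).isWeaklyRegular_congr] at hys
    exact ih (hM.quotient hreg) hys

end PowCancels

theorem RingTheory.Sequence.isWeaklyRegular_map_pow_iff {n : ℕ} (hn : 0 < n) (xs : List R) :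
    ∀ {M : Type w} [AddCommGroup M] [Module R M],
      IsWeaklyRegular M (xs.map (· ^ n)) ↔ IsWeaklyRegular M xs := by
  induction xs with
  | nil => intro M _ _; rfl
  | cons x xs ih =>
    intro M _ _
    rw [List.map_cons, isWeaklyRegular_cons_iff, isWeaklyRegular_cons_iff,
      IsSMulRegular.pow_iff hn, ih]
    -- The induction hypothesis has removed the powers from the tail, over `M / x ^ n M`; it remains
    -- to replace `x ^ n` by `x ^ 1`.
    refine and_congr_right fun hx => ?_
    conv_rhs => rw [← pow_one x]
    have hM := hx.powCancels n
    exact ⟨PowCancels.isWeaklyRegular hn le_rfl hn xs hM,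
      PowCancels.isWeaklyRegular one_pos hn le_rfl xs hM⟩

end Powers

/-! ### Kunz: flatness of Frobenius. -/

section Kunz

open IsLocalRing RingTheory.Sequence

/-- The Frobenius endomorphism of a regular local ring is flat. -/
theorem IsRegularLocalRing.frobenius_flat (R : Type u) [CommRing R] [IsRegularLocalRing R] (p : ℕ)
    [Fact p.Prime] [CharP R p] : (frobenius R p).Flat := by
  have hp : 0 < p := (Fact.out : p.Prime).pos
  obtain ⟨xs, hxs, hreg⟩ := exists_ofList_eq_maximalIdeal_and_isWeaklyRegular R
  have : IsLocalRing (FrobRing R p) := inferInstanceAs (IsLocalRing R)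
  have : IsNoetherianRing (FrobRing R p) := inferInstanceAs (IsNoetherianRing R)
  have hwr : IsWeaklyRegular (FrobRing R p) xs := by
    have h : IsWeaklyRegular R (xs.map (· ^ p)) := (isWeaklyRegular_map_pow_iff hp xs).mpr hreg
    exact (isWeaklyRegular_map_algebraMap_iff (S := FrobRing R p) (M := FrobRing R p) xs).mp h
  have hinj := hwr.lTensor_subtype_ofList_injective
  rw [hxs] at hinj
  refine Module.Flat.of_lTensor_maximalIdeal_injective (S := FrobRing R p) ?_ hinj
  refine ne_top_of_le_ne_top (maximalIdeal.isMaximal (FrobRing R p)).ne_top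
    (Ideal.map_le_iff_le_comap.mpr fun r hr => ?_)
  exact Ideal.pow_mem_of_mem (maximalIdeal R) hr p hp

/-- The Frobenius endomorphism of a regular ring is flat. -/
theorem IsRegularRing.flat_frobRing (R : Type u) [CommRing R] [IsRegularRing R] (p : ℕ)
    [Fact p.Prime] [CharP R p] : Module.Flat R (FrobRing R p) := by
  have hp : p.Prime := Fact.out
  refine RingHom.Flat.ofLocalizationPrime (frobenius R p) fun P hP => ?_
  have hcomap : P = P.comap (frobenius R p) := by
    ext r
    exact ⟨fun h => Ideal.pow_mem_of_mem P h p hp.pos, fun h => hP.mem_of_pow_mem p h⟩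
  have hchar : CharP (Localization.AtPrime P) p := by
    rw [CharP.charP_iff_prime_eq_zero hp, ← map_natCast (algebraMap R _), CharP.cast_eq_zero,
      map_zero]
  -- The source prime is generalized so that it can be identified with `P`; the induced map is then
  -- the Frobenius of `R_P`.
  have key : ∀ (Q : Ideal R) [Q.IsPrime] (hQ : Q = P.comap (frobenius R p)),
      (Localization.localRingHom Q P (frobenius R p) hQ).Flat := by
    intro Q _ hQ
    obtain rfl : Q = P := hQ.trans hcomap.symm
    rw [Localization.localRingHom_unique Q Q (frobenius R p) hQ
      (j := frobenius (Localization.AtPrime Q) p) fun r => by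
        rw [frobenius_def, frobenius_def, map_pow]]
    exact IsRegularLocalRing.frobenius_flat _ p
  exact key _ rfl

end Kunz

/-! ### Filter-regularity prime by prime, direct limits, and existence. -/

section RegularModAt

open RingTheory.Sequence

variable {R : Type*} [CommRing R]

/-- The element `a` is regular on the localization of `M / I M` at the prime `q`. -/
def IsRegularModAt (q I : Ideal R) (M : Type*) [AddCommGroup M] [Module R M] (a : R) : Prop :=
  ∀ m : M, a • m ∈ I • (⊤ : Submodule R M) → ∃ s ∉ q, s • m ∈ I • (⊤ : Submodule R M)

theorem IsRegularModAt.of_linearEquiv {q I : Ideal R} {M M' : Type*} [AddCommGroup M] [Module R M]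
    [AddCommGroup M'] [Module R M'] {a : R} (h : IsRegularModAt q I M a) (e : M ≃ₗ[R] M') :
    IsRegularModAt q I M' a := by
  intro m hm
  obtain ⟨s, hs, hsm⟩ := h (e.symm m) (by
    rw [← map_smul]
    exact Submodule.smul_top_le_comap_smul_top I e.symm.toLinearMap hm)
  refine ⟨s, hs, ?_⟩
  rw [← map_smul] at hsm
  simpa using Submodule.smul_top_le_comap_smul_top I e.toLinearMap hsm

theorem iSup_smul_top_eq_span_smul_top {M : Type*} [AddCommGroup M] [Module R M] (g : ℕ → R) {t : ℕ}
    (i : Fin t) : (⨆ j < i, g j • (⊤ : Submodule R M)) =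
      Ideal.span (g '' Set.Iio (i : ℕ)) • (⊤ : Submodule R M) := by
  refine le_antisymm (iSup₂_le fun j hj => ?_) (Submodule.smul_le.mpr fun r hr m _ => ?_)
  · rw [← Submodule.ideal_span_singleton_smul]
    refine Submodule.smul_mono_left ?_
    exact (Ideal.span_singleton_le_iff_mem _).mpr (Ideal.subset_span ⟨j, hj, rfl⟩)
  · induction hr using Submodule.span_induction with
    | mem x hx =>
      obtain ⟨j, hj, rfl⟩ := hx
      have hji : (⟨j, (Set.mem_Iio.mp hj).trans i.2⟩ : Fin t) < i := hj
      exact Submodule.mem_iSup_of_mem _ (Submodule.mem_iSup_of_mem hji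
        (Submodule.smul_mem_pointwise_smul m (g j) ⊤ trivial))
    | zero => rw [zero_smul]; exact zero_mem _
    | add x y _ _ hx hy => rw [add_smul]; exact add_mem hx hy
    | smul c x _ hx => rw [smul_assoc]; exact Submodule.smul_mem _ c hx

theorem notMem_support_submoduleOf_iff {M : Type*} [AddCommGroup M] [Module R M]
    {P C : Submodule R M} {q : PrimeSpectrum R} :
    q ∉ Module.support R (C ⧸ P.submoduleOf C) ↔
      ∀ m ∈ C, ∃ s ∉ q.asIdeal, s • m ∈ P := by
  rw [Module.notMem_support_iff']
  constructor
  · intro h m hm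
    obtain ⟨s, hs, hsm⟩ := h (Submodule.mkQ _ ⟨m, hm⟩)
    rw [← map_smul, ← LinearMap.mem_ker, Submodule.ker_mkQ] at hsm
    exact ⟨s, hs, hsm⟩
  · intro h m
    obtain ⟨m, rfl⟩ := Submodule.mkQ_surjective _ m
    obtain ⟨s, hs, hsm⟩ := h m m.2
    refine ⟨s, hs, ?_⟩
    rw [← map_smul, ← LinearMap.mem_ker, Submodule.ker_mkQ]
    exact hsm

theorem isInfiniteFilterRegularSeq_iff {𝔞 : Ideal R} {M : Type*} [AddCommGroup M] [Module R M]
    {g : ℕ → R} : IsInfiniteFilterRegularSeq 𝔞 M g ↔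
      ∀ q : PrimeSpectrum R, ¬ 𝔞 ≤ q.asIdeal → ∀ i,
        IsRegularModAt q.asIdeal (Ideal.span (g '' Set.Iio i)) M (g i) := by
  have h : ∀ (t : ℕ) (i : Fin t),
      (Module.support R (((⨆ j < i, g j • (⊤ : Submodule R M)).comap (LinearMap.lsmul R M (g i))) ⧸
        (⨆ j < i, g j • (⊤ : Submodule R M)).submoduleOf
          ((⨆ j < i, g j • (⊤ : Submodule R M)).comap (LinearMap.lsmul R M (g i)))) ⊆
        PrimeSpectrum.zeroLocus (𝔞 : Set R)) ↔ ∀ q : PrimeSpectrum R, ¬ 𝔞 ≤ q.asIdeal →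
        IsRegularModAt q.asIdeal (Ideal.span (g '' Set.Iio (i : ℕ))) M (g i) := by
    intro t i
    refine forall_congr' fun q => ?_
    rw [← not_imp_not, notMem_support_submoduleOf_iff, iSup_smul_top_eq_span_smul_top]
    rfl
  constructor
  · intro H q hq i
    exact (h (i + 1) (Fin.last i)).mp (H (i + 1) (Fin.last i)) q hq
  · intro H t i
    exact (h t i).mpr fun q hq => H q hq i

theorem LocalizedModule.mk_mem_smul_top_iff {S : Submonoid R} {I : Ideal R} {M : Type*}
    [AddCommGroup M] [Module R M] {m : M} {s : S} :
    LocalizedModule.mk m s ∈ I • (⊤ : Submodule R (LocalizedModule S M)) ↔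
      ∃ u ∈ S, u • m ∈ I • (⊤ : Submodule R M) := by
  constructor
  · intro h
    obtain ⟨y, hy, t, ht⟩ : ∃ y ∈ I • (⊤ : Submodule R M), ∃ t : S,
        LocalizedModule.mk m s = LocalizedModule.mk y t := by
      generalize LocalizedModule.mk m s = x at h
      induction h using Submodule.smul_induction_on' with
      | smul r hr x _ =>
        induction x using LocalizedModule.induction_on with
        | h y t => exact ⟨r • y, Submodule.smul_mem_smul hr trivial, t, LocalizedModule.smul'_mk _ _ _⟩
      | add x _ y _ hx hy =>
        obtain ⟨x', hx', t, rfl⟩ := hx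
        obtain ⟨y', hy', t', rfl⟩ := hy
        exact ⟨_, add_mem (Submodule.smul_of_tower_mem _ t' hx')
          (Submodule.smul_of_tower_mem _ t hy'), t * t', LocalizedModule.mk_add_mk⟩
    obtain ⟨u, hu⟩ := LocalizedModule.mk_eq.mp ht
    refine ⟨u * t, S.mul_mem u.2 t.2, ?_⟩
    have hu' : (u : R) • (t : R) • m = (u : R) • (s : R) • y := hu
    rw [mul_smul, hu']
    exact Submodule.smul_mem _ _ (Submodule.smul_mem _ _ hy)
  · rintro ⟨u, hu, hm⟩
    have key : ∀ y ∈ I • (⊤ : Submodule R M), ∀ t : S,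
        LocalizedModule.mk y t ∈ I • (⊤ : Submodule R (LocalizedModule S M)) := by
      intro y hy t
      induction hy using Submodule.smul_induction_on' with
      | smul r hr y _ =>
        rw [← LocalizedModule.smul'_mk]
        exact Submodule.smul_mem_smul hr trivial
      | add x _ y _ hx hy =>
        rw [← LocalizedModule.mk_cancel_common_left t t, smul_add, ← LocalizedModule.mk_add_mk]
        exact add_mem hx hy
    rw [← LocalizedModule.mk_cancel_common_left ⟨u, hu⟩ s m]
    exact key _ hm _

theorem isRegularModAt_iff {q : Ideal R} [q.IsPrime] {I : Ideal R} {M : Type*} [AddCommGroup M]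
    [Module R M] {a : R} : IsRegularModAt q I M a ↔ IsSMulRegular
      (LocalizedModule q.primeCompl M ⧸ I • (⊤ : Submodule R (LocalizedModule q.primeCompl M))) a := by
  rw [isSMulRegular_quotient_iff_mem_of_smul_mem]
  constructor
  · intro h x
    induction x using LocalizedModule.induction_on with
    | h m s =>
      rw [LocalizedModule.smul'_mk, LocalizedModule.mk_mem_smul_top_iff,
        LocalizedModule.mk_mem_smul_top_iff]
      rintro ⟨u, hu, hum⟩
      rw [smul_comm] at hum
      obtain ⟨s, hs, hsm⟩ := h _ hum
      exact ⟨s * u, q.primeCompl.mul_mem hs hu, by rwa [mul_smul]⟩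
  · intro h m hm
    have h1 := h (LocalizedModule.mk m 1) (by
      rw [LocalizedModule.smul'_mk, LocalizedModule.mk_mem_smul_top_iff]
      exact ⟨1, q.primeCompl.one_mem, by rwa [one_smul]⟩)
    exact LocalizedModule.mk_mem_smul_top_iff.mp h1

/-- This translation makes the results on powers of weakly regular sequences available at each
prime. -/
theorem forall_isRegularModAt_iff {q : Ideal R} [q.IsPrime] {M : Type*} [AddCommGroup M]
    [Module R M] {g : ℕ → R} :
    (∀ i, IsRegularModAt q (Ideal.span (g '' Set.Iio i)) M (g i)) ↔
      ∀ t, IsWeaklyRegular (LocalizedModule q.primeCompl M) ((List.range t).map g) := by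
  have hspan : ∀ i t, i ≤ t → Ideal.ofList (((List.range t).map g).take i) =
      Ideal.span (g '' Set.Iio i) := by
    intro i t hit
    rw [← List.map_take, List.take_range, min_eq_left hit, Ideal.ofList]
    congr 1
    ext r
    simp
  constructor
  · intro h t
    refine ⟨fun i hi => ?_⟩
    rw [List.length_map, List.length_range] at hi
    rw [hspan i t hi.le, List.getElem_map, List.getElem_range, ← isRegularModAt_iff]
    exact h i
  · intro h i
    have h1 := (h (i + 1)).regular_mod_prev i (by simp)
    rwa [hspan i (i + 1) (Nat.le_succ i), List.getElem_map, List.getElem_range,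
      ← isRegularModAt_iff] at h1

theorem forall_isRegularModAt_of_pow {q : Ideal R} [q.IsPrime] {M : Type*} [AddCommGroup M]
    [Module R M] {g : ℕ → R} {n : ℕ} (hn : 0 < n)
    (h : ∀ i, IsRegularModAt q (Ideal.span ((fun j => g j ^ n) '' Set.Iio i)) M (g i ^ n)) (i : ℕ) :
    IsRegularModAt q (Ideal.span (g '' Set.Iio i)) M (g i) := by
  have h1 := forall_isRegularModAt_iff.mp h
  refine forall_isRegularModAt_iff.mpr (fun t => ?_) i
  rw [← isWeaklyRegular_map_pow_iff hn, List.map_map]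
  exact h1 t

/-- Both `m` and the membership `a m ∈ I M` descend to a finite stage `l`; the multiplier found
there maps forward to the limit. -/
theorem IsRegularModAt.directLimit {ι : Type*} [Preorder ι] [DecidableEq ι] [Nonempty ι]
    [IsDirectedOrder ι] {G : ι → Type*} [∀ i, AddCommGroup (G i)] [∀ i, Module R (G i)]
    {f : ∀ i j, i ≤ j → G i →ₗ[R] G j} [DirectedSystem G fun i j h => f i j h] {q I : Ideal R}
    {a : R} (h : ∀ i, IsRegularModAt q I (G i) a) :
    IsRegularModAt q I (Module.DirectLimit G f) a := by
  have hlift : ∀ y ∈ I • (⊤ : Submodule R (Module.DirectLimit G f)), ∃ i,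
      ∃ z ∈ I • (⊤ : Submodule R (G i)), Module.DirectLimit.of R ι G f i z = y := by
    intro y hy
    induction hy using Submodule.smul_induction_on' with
    | smul r hr y _ =>
      obtain ⟨i, z, rfl⟩ := Module.DirectLimit.exists_of y
      exact ⟨i, r • z, Submodule.smul_mem_smul hr trivial, map_smul _ _ _⟩
    | add x _ y _ hx hy =>
      obtain ⟨i, x', hx', rfl⟩ := hx
      obtain ⟨j, y', hy', rfl⟩ := hy
      obtain ⟨k, hik, hjk⟩ := exists_ge_ge i j
      refine ⟨k, f i k hik x' + f j k hjk y',
        add_mem (Submodule.smul_top_le_comap_smul_top I (f i k hik) hx')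
          (Submodule.smul_top_le_comap_smul_top I (f j k hjk) hy'), ?_⟩
      rw [map_add, Module.DirectLimit.of_f, Module.DirectLimit.of_f]
  intro m hm
  obtain ⟨i, x, rfl⟩ := Module.DirectLimit.exists_of m
  obtain ⟨j, y, hy, hxy⟩ := hlift _ hm
  obtain ⟨k, hik, hjk⟩ := exists_ge_ge i j
  have h0 : Module.DirectLimit.of R ι G f k (a • f i k hik x - f j k hjk y) = 0 := by
    rw [map_sub, map_smul, Module.DirectLimit.of_f, Module.DirectLimit.of_f, hxy, sub_self]
  obtain ⟨l, hkl, hl⟩ := Module.DirectLimit.of.zero_exact h0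
  rw [map_sub, map_smul, sub_eq_zero] at hl
  obtain ⟨s, hs, hsm⟩ := h l (f k l hkl (f i k hik x)) (by
    rw [hl]
    exact Submodule.smul_top_le_comap_smul_top I (f k l hkl)
      (Submodule.smul_top_le_comap_smul_top I (f j k hjk) hy))
  refine ⟨s, hs, ?_⟩
  have h1 := Submodule.smul_top_le_comap_smul_top I (Module.DirectLimit.of R ι G f l) hsm
  rwa [Submodule.mem_comap, map_smul, Module.DirectLimit.of_f, Module.DirectLimit.of_f] at h1

/-- Choose `a ∈ 𝔞` outside the associated primes of `N / IN` that do not contain `𝔞`. If regularity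
failed at `q` for the class of `m`, a minimal prime of its annihilator inside `q` would be such an
associated prime, yet would contain `a`. -/
theorem exists_mem_forall_isRegularModAt [IsNoetherianRing R] (𝔞 I : Ideal R) (N : Type*)
    [AddCommGroup N] [Module R N] [Module.Finite R N] :
    ∃ a ∈ 𝔞, ∀ q : PrimeSpectrum R, ¬ 𝔞 ≤ q.asIdeal → IsRegularModAt q.asIdeal I N a := by
  set L := N ⧸ I • (⊤ : Submodule R N)
  obtain ⟨a, ha, hP⟩ : ∃ a ∈ 𝔞, ∀ P ∈ associatedPrimes R L, ¬ 𝔞 ≤ P → a ∉ P := by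
    by_contra! hcon
    have hsub : (𝔞 : Set R) ⊆
        ⋃ P ∈ {P ∈ associatedPrimes R L | ¬ 𝔞 ≤ P}, (P : Set R) := by
      intro x hx
      obtain ⟨P, hP, hle, hxP⟩ := hcon x hx
      exact Set.mem_biUnion (show P ∈ {P ∈ associatedPrimes R L | ¬ 𝔞 ≤ P} from ⟨hP, hle⟩) hxP
    obtain ⟨P, hP, hle⟩ := (Ideal.subset_union_prime_finite
      ((associatedPrimes.finite R L).subset (Set.sep_subset _ _)) (f := id)
      -- All the ideals are prime, so the two exceptional indices are arbitrary.
      0 0 fun P hP _ _ => hP.1.isPrime).mp hsub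
    exact hP.2 hle
  refine ⟨a, ha, fun q hq m hm => ?_⟩
  by_contra! hcon
  let m' : L := Submodule.mkQ _ m
  have hmem : ∀ r : R, r • m' = 0 ↔ r • m ∈ I • (⊤ : Submodule R N) := fun r => by
    rw [← map_smul, ← LinearMap.mem_ker, Submodule.ker_mkQ]
  have hann : Module.annihilator R (Submodule.span R {m'}) ≤ q.asIdeal := by
    intro r hr
    by_contra hrq
    refine hcon r hrq ((hmem r).mp ?_)
    exact congrArg Subtype.val
      (Module.mem_annihilator.mp hr ⟨m', Submodule.mem_span_singleton_self m'⟩)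
  obtain ⟨P, hPmin, hPq⟩ := Ideal.exists_minimalPrimes_le hann
  have hPass : P ∈ associatedPrimes R (Submodule.span R {m'}) :=
    Module.associatedPrimes.minimalPrimes_annihilator_subset_associatedPrimes R _ hPmin
  have haP : a ∈ P := by
    refine hPmin.1.2 (Module.mem_annihilator.mpr ?_)
    rintro ⟨y, hy⟩
    obtain ⟨r, rfl⟩ := Submodule.mem_span_singleton.mp hy
    exact Subtype.ext (by
      show a • r • m' = 0
      rw [smul_comm, (hmem a).mpr hm, smul_zero])
  exact hP P (associatedPrimes.subset_of_injective (Submodule.injective_subtype _) hPass)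
    (fun hle => hq (hle.trans hPq)) haP

/-- Over a Noetherian ring, an ideal contains an infinite filter-regular sequence on every finitely
generated module. -/
theorem exists_isInfiniteFilterRegularSeq [IsNoetherianRing R] (𝔞 : Ideal R) (N : Type*)
    [AddCommGroup N] [Module R N] [Module.Finite R N] :
    ∃ g : ℕ → R, (∀ i, g i ∈ 𝔞) ∧ IsInfiniteFilterRegularSeq 𝔞 N g := by
  choose c hc hreg using fun I : Ideal R => exists_mem_forall_isRegularModAt 𝔞 I N
  -- `J i` is the ideal of the terms chosen before `i`; the choice of the next term depends only on
  -- it.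
  let J : ℕ → Ideal R := fun i => Nat.rec ⊥ (fun _ I => I ⊔ Ideal.span {c I}) i
  have hJ : ∀ i, Ideal.span ((fun j => c (J j)) '' Set.Iio i) = J i := by
    intro i
    induction i with
    | zero => simp [J]
    | succ i ih =>
      have : Set.Iio (i + 1) = Set.Iio i ∪ {i} := by ext; simp
      rw [this, Set.image_union, Ideal.span_union, ih, Set.image_singleton]
  refine ⟨fun i => c (J i), fun i => hc _, isInfiniteFilterRegularSeq_iff.mpr fun q hq i => ?_⟩
  rw [hJ]
  exact hreg _ q hq

end RegularModAt

/-! ### Transport of regularity through the Frobenius functor. -/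

section FrobeniusFunctor

variable {R : Type u} [CommRing R] {p : ℕ} [Fact p.Prime] [CharP R p]

namespace Frob

variable {M N P : Type*} [AddCommGroup M] [Module R M] [AddCommGroup N] [Module R N]
  [AddCommGroup P] [Module R P]

theorem induction {motive : Frob R p M → Prop} (zero : motive 0)
    (tmul : ∀ (s : R) (m : M), motive (tmul p s m))
    (add : ∀ x y, motive x → motive y → motive (x + y)) (x : Frob R p M) : motive x :=
  TensorProduct.induction_on (motive := motive) x zero
    (fun s m => tmul ((FrobRing.of R p).symm s) m) add

theorem map_lsmul (a : R) (x : Frob R p M) :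
    map p (LinearMap.lsmul R M a) x = a ^ p • x := by
  induction x using Frob.induction with
  | zero => rw [map_zero, smul_zero]
  | tmul s m => rw [map_tmul, LinearMap.lsmul_apply, Frob.tmul_smul, Frob.smul_tmul]
  | add x y hx hy => rw [map_add, hx, hy, smul_add]

theorem map_exact_of_flat [Module.Flat R (FrobRing R p)] {f : M →ₗ[R] N} {g : N →ₗ[R] P}
    (h : Function.Exact f g) : Function.Exact (map p f) (map p g) :=
  Module.Flat.lTensor_exact (FrobRing R p) h

theorem map_exact_of_surjective {f : M →ₗ[R] N} {g : N →ₗ[R] P}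
    (h : Function.Exact f g) (hg : Function.Surjective g) : Function.Exact (map p f) (map p g) :=
  lTensor_exact (FrobRing R p) h hg

/-- This identifies `F(M / IM)` with `F(M) / I^[p] F(M)`: right exactness gives one direction, and
`I^[p]` annihilating `F(M / IM)` the other. -/
theorem map_mkQ_smul_top_eq_zero_iff (I : Ideal R) (x : Frob R p M) :
    map p (I • (⊤ : Submodule R M)).mkQ x = 0 ↔
      x ∈ I.map (frobenius R p) • (⊤ : Submodule R (Frob R p M)) := by
  constructor
  · intro h
    obtain ⟨y, rfl⟩ := (map_exact_of_surjective (LinearMap.exact_subtype_mkQ _)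
      (Submodule.mkQ_surjective _) x).mp h
    clear h
    induction y using Frob.induction with
    | zero => rw [map_zero]; exact zero_mem _
    | tmul s y =>
      obtain ⟨y, hy⟩ := y
      rw [map_tmul, Submodule.subtype_apply]
      dsimp only
      induction hy using Submodule.smul_induction_on' with
      | smul r hr m _ =>
        rw [Frob.tmul_smul, ← Frob.smul_tmul]
        exact Submodule.smul_mem_smul (Ideal.mem_map_of_mem (frobenius R p) hr) trivial
      | add y _ z _ hy hz =>
        have : Frob.tmul p s (y + z) = Frob.tmul p s y + Frob.tmul p s z :=
          TensorProduct.tmul_add _ _ _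
        rw [this]
        exact add_mem hy hz
    | add x y hx hy => rw [map_add]; exact add_mem hx hy
  · intro h
    have hann : I.map (frobenius R p) ≤
        Module.annihilator R (Frob R p (M ⧸ I • (⊤ : Submodule R M))) := by
      refine Ideal.map_le_iff_le_comap.mpr fun r hr => Module.mem_annihilator.mpr fun z => ?_
      rw [frobenius_def, ← map_lsmul]
      have hzero : LinearMap.lsmul R (M ⧸ I • (⊤ : Submodule R M)) r = 0 := by
        ext m
        rw [LinearMap.comp_apply, LinearMap.lsmul_apply, ← map_smul, LinearMap.zero_comp,
          LinearMap.zero_apply, ← LinearMap.mem_ker, Submodule.ker_mkQ]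
        exact Submodule.smul_mem_smul hr trivial
      rw [hzero]
      exact LinearMap.congr_fun (LinearMap.baseChange_zero (A := FrobRing R p)) z
    induction h using Submodule.smul_induction_on' with
    | smul r hr x _ => rw [map_smul, Module.mem_annihilator.mp (hann hr)]
    | add x _ y _ hx hy => rw [map_add, hx, hy, add_zero]

theorem exists_notMem_smul_eq_zero {q : Ideal R} [q.IsPrime] (h : ∀ m : M, ∃ s ∉ q, s • m = 0)
    (x : Frob R p M) : ∃ s ∉ q, s • x = 0 := by
  induction x using Frob.induction with
  | zero => exact ⟨1, q.one_notMem, smul_zero _⟩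
  | tmul s m =>
    obtain ⟨u, hu, hum⟩ := h m
    refine ⟨u ^ p, fun hup => hu (Ideal.IsPrime.mem_of_pow_mem ‹_› p hup), ?_⟩
    rw [Frob.smul_tmul, ← Frob.tmul_smul, hum]
    exact TensorProduct.tmul_zero _ _
  | add x y hx hy =>
    obtain ⟨u, hu, hux⟩ := hx
    obtain ⟨t, ht, hty⟩ := hy
    refine ⟨u * t, q.primeCompl.mul_mem hu ht, ?_⟩
    rw [smul_add, mul_smul _ _ y, hty, smul_zero, add_zero, mul_comm, mul_smul, hux, smul_zero]

end Frob

/-- The kernel `K` of `a` on `N / IN` vanishes at `q`. By flatness the kernel of `a ^ p` on `F(N /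
IN)` is the image of `F(K)`, which vanishes at `q` too: if `s` kills `m`, then `s ^ p` kills `t ⊗
m`. -/
theorem IsRegularModAt.frob [Module.Flat R (FrobRing R p)] {q I : Ideal R} [q.IsPrime]
    {N : Type*} [AddCommGroup N] [Module R N] {a : R} (h : IsRegularModAt q I N a) :
    IsRegularModAt q (I.map (frobenius R p)) (Frob R p N) (a ^ p) := by
  intro x hx
  let L := N ⧸ I • (⊤ : Submodule R N)
  let K := LinearMap.ker (LinearMap.lsmul R L a)
  have hK : ∀ k : K, ∃ s ∉ q, s • k = 0 := by
    rintro ⟨k, hk⟩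
    obtain ⟨m, rfl⟩ := Submodule.mkQ_surjective _ k
    rw [LinearMap.mem_ker, LinearMap.lsmul_apply, ← map_smul, ← LinearMap.mem_ker,
      Submodule.ker_mkQ] at hk
    obtain ⟨s, hs, hsm⟩ := h m hk
    refine ⟨s, hs, Subtype.ext ?_⟩
    show s • Submodule.mkQ _ m = 0
    rw [← map_smul, ← LinearMap.mem_ker, Submodule.ker_mkQ]
    exact hsm
  have h1 : Frob.map p (LinearMap.lsmul R L a)
      (Frob.map p (I • (⊤ : Submodule R N)).mkQ x) = 0 := by
    rw [Frob.map_lsmul, ← map_smul]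
    exact (Frob.map_mkQ_smul_top_eq_zero_iff I _).mpr hx
  obtain ⟨w, hw⟩ := (Frob.map_exact_of_flat (LinearMap.exact_subtype_ker_map _) _).mp h1
  obtain ⟨s, hs, hsw⟩ := Frob.exists_notMem_smul_eq_zero hK w
  refine ⟨s, hs, (Frob.map_mkQ_smul_top_eq_zero_iff I _).mp ?_⟩
  rw [map_smul, ← hw, ← map_smul, hsw, map_zero]

/-- Frobenius replaces `g` by its `p`-th powers; dropping the exponent gives back the same sequence,
so the step can be iterated. -/
theorem forall_isRegularModAt_frob [Module.Flat R (FrobRing R p)] {q : Ideal R} [q.IsPrime]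
    {N : Type*} [AddCommGroup N] [Module R N] {g : ℕ → R}
    (h : ∀ i, IsRegularModAt q (Ideal.span (g '' Set.Iio i)) N (g i)) (i : ℕ) :
    IsRegularModAt q (Ideal.span (g '' Set.Iio i)) (Frob R p N) (g i) := by
  refine forall_isRegularModAt_of_pow (Fact.out : p.Prime).pos (fun i => ?_) i
  have h1 := (h i).frob (p := p)
  rw [Ideal.map_span, Set.image_image] at h1
  exact h1

theorem Frob.directedSystem_transition {N : Type (max u v)} [AddCommGroup N] [Module R N]
    (β : N →ₗ[R] Frob R p N) : DirectedSystem (fun i => Frob.iter.{u, v} R p N i)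
      fun i j h => Frob.transition.{u, v} p β i j h where
  map_self i x := by rw [Frob.transition_self]; rfl
  map_map k j i hij hjk x := by
    induction k, hjk using Nat.le_induction with
    | base => rw [Frob.transition_self]; rfl
    | succ k hjk ih =>
      rw [Frob.transition_succ p β j k hjk, Frob.transition_succ p β i k (hij.trans hjk)]
      exact congrArg _ ih

end FrobeniusFunctor

/-! ### The theorem. -/

theorem theorem5p8 {R : Type u} [CommRing R] [IsRegularRing R] (p : ℕ) [Fact p.Prime] [CharP R p]
    (𝔞 : Ideal R) (h𝔞 : 𝔞 ≠ ⊤)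
    (M : Type w) [AddCommGroup M] [Module R M] (θ : M ≃ₗ[R] Frob R p M)
    (N : Type (max u v)) [AddCommGroup N] [Module R N] (hN : IsRoot.{u, v, w} p N θ) :
    (∃ g : ℕ → R, (∀ i, g i ∈ 𝔞) ∧ IsInfiniteFilterRegularSeq 𝔞 N g) ∧
      ∀ g : ℕ → R, (∀ i, g i ∈ 𝔞) → IsInfiniteFilterRegularSeq 𝔞 N g →
        IsInfiniteFilterRegularSeq 𝔞 M g := by
  obtain ⟨hfin, β, -, e, -⟩ := hN
  refine ⟨exists_isInfiniteFilterRegularSeq 𝔞 N, fun g _ hg => ?_⟩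
  rw [isInfiniteFilterRegularSeq_iff] at hg ⊢
  intro q hq
  have := IsRegularRing.flat_frobRing R p
  have := Frob.directedSystem_transition.{u, v} β
  have hiter : ∀ k i, IsRegularModAt q.asIdeal (Ideal.span (g '' Set.Iio i))
      (Frob.iter.{u, v} R p N k) (g i) := by
    intro k
    induction k with
    | zero => exact hg q hq
    | succ k ih => exact forall_isRegularModAt_frob ih
  intro i
  exact (IsRegularModAt.directLimit (f := Frob.transition.{u, v} p β)
    fun k => hiter k i).of_linearEquiv e
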